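/- Let $S^2$ be the round unit sphere. A geodesic arc is an arc of a great circle of positive length at most $2\pi$. A *spherical polygon* is a connected set $P\subset S^2$ that equals the closure of its interior and whose boundary is the union of finitely many (at least one) geodesic arcs, its sides, which meet one another only at their endpoints, the corners of $P$. ($P$ need not be convex or simply connected, sides may be longer than $\pi$, and no admissibility is assumed, i.e. it is not required that, for every side $a$, the union of $P$ and its mirror image in the great circle through $a$ lie in an open hemisphere.) A *regular chord* of $P$ is a directed geodesic segment of positive length whose endpoints are interior points of sides of $P$ and all of whose other points lie in the interior of $P$. A *regular $n$-segment billiard orbit* in $P$ is a sequence $x_1,\dots,x_n$ of regular chords such that, for $1\le i<n$, the chord $x_{i+1}$ starts at the end of $x_i$, in the direction obtained from the final direction of $x_i$ by the geodesic reflection about the side on which $x_i$ ends. Its *side code* is the word $s_1s_2\cdots s_{n+1}$ in the sides of $P$, where $x_i$ starts on $s_i$ for $1\le i\le n$, and $x_n$ ends on $s_{n+1}$. The *side complexity* $F(n)$ of $P$ is the number of words of length $n+1$ that are side codes of regular $n$-segment billiard orbits in $P$. **Theorem.** For every spherical polygon $P$ the side complexity grows subexponentially: for every $\varepsilon>0$,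 $F(n)=o(e^{\varepsilon n})$ as $n\to\infty$. -/

import Mathlib

open Asymptotics Filter

/-- Euclidean three-space, the ambient space of the unit sphere. -/
abbrev E3 : Type := EuclideanSpace ℝ (Fin 3)

/-- The round unit sphere. -/
abbrev S2 : Type := Metric.sphere (0 : E3) 1

/-- A unit tangent vector of the sphere: a foot point together with a unit direction tangent
there.  It is the same thing as an oriented great circle with a marked point. -/
@[ext]
structure UnitTangent where
  /-- the foot point -/
  pt : E3
  /-- the direction -/
  dir : E3
  norm_pt : ‖pt‖ = 1
  norm_dir : ‖dir‖ = 1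
  inner_eq_zero : inner ℝ pt dir = 0

namespace UnitTangent

theorem norm_comb (x : UnitTangent) {a b : ℝ} (h : a ^ 2 + b ^ 2 = 1) :
    ‖a • x.pt + b • x.dir‖ = 1 := by
  have h1 : ‖a • x.pt + b • x.dir‖ ^ 2 = 1 := by
    rw [norm_add_sq_real, norm_smul, norm_smul, x.norm_pt, x.norm_dir, inner_smul_left,
      inner_smul_right, x.inner_eq_zero]
    simp [h]
  nlinarith [norm_nonneg (a • x.pt + b • x.dir)]

/-- The point reached after time `t` along the unit speed geodesic (great circle) issuing from the
unit tangent vector `x`. -/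
noncomputable def geod (x : UnitTangent) (t : ℝ) : S2 :=
  ⟨Real.cos t • x.pt + Real.sin t • x.dir, by
    rw [mem_sphere_zero_iff_norm]
    exact x.norm_comb (Real.cos_sq_add_sin_sq t)⟩

/-- The geodesic flow: foot point and velocity after time `t`. -/
noncomputable def flow (x : UnitTangent) (t : ℝ) : UnitTangent where
  pt := Real.cos t • x.pt + Real.sin t • x.dir
  dir := (-Real.sin t) • x.pt + Real.cos t • x.dir
  norm_pt := x.norm_comb (Real.cos_sq_add_sin_sq t)
  norm_dir := x.norm_comb (by rw [neg_sq]; exact Real.sin_sq_add_cos_sq t)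
  inner_eq_zero := by
    have h : inner ℝ x.dir x.pt = 0 := by rw [real_inner_comm]; exact x.inner_eq_zero
    simp only [inner_add_left, inner_add_right, real_inner_smul_left, real_inner_smul_right,
      real_inner_self_eq_norm_sq, x.norm_pt, x.norm_dir, x.inner_eq_zero, h]
    ring

/-- The action of a linear isometry of three-space (an isometry of the sphere) on unit tangent
vectors. -/
noncomputable def map (g : E3 ≃ₗᵢ[ℝ] E3) (x : UnitTangent) : UnitTangent where
  pt := g x.pt
  dir := g x.dir
  norm_pt := by rw [g.norm_map, x.norm_pt]
  norm_dir := by rw [g.norm_map, x.norm_dir]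
  inner_eq_zero := by rw [g.inner_map_map, x.inner_eq_zero]

end UnitTangent

/-- A geodesic arc on the sphere: it starts at the foot point of `frame`, leaves in the direction
of `frame`, and has length `len`.  Arcs of length `π` or more are allowed. -/
structure GeodesicArc where
  frame : UnitTangent
  len : ℝ
  len_pos : 0 < len
  len_le : len ≤ 2 * Real.pi

namespace GeodesicArc

/-- The closed arc. -/
def carrier (a : GeodesicArc) : Set S2 := a.frame.geod '' Set.Icc 0 a.len

/-- The arc without its endpoints. -/
def relInterior (a : GeodesicArc) : Set S2 := a.frame.geod '' Set.Ioo 0 a.len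

/-- The geodesic reflection of the sphere about the great circle that contains the arc. -/
noncomputable def reflection (a : GeodesicArc) : E3 ≃ₗᵢ[ℝ] E3 :=
  (Submodule.span ℝ {a.frame.pt, a.frame.dir}).reflection

end GeodesicArc

/-- A spherical polygon: a connected region of the sphere, equal to the closure of its interior,
whose boundary is the union of finitely many geodesic arcs (the sides), which meet only at their
endpoints (the corners).  It need not be convex, simply connected, or contained in a hemisphere,
and several boundary curves may touch at a corner. -/
structure SphericalPolygon where
  carrier : Set S2
  numSides : ℕ
  side : Fin numSides → GeodesicArc
  numSides_pos : 0 < numSides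
  isConnected : IsConnected carrier
  closure_interior : closure (interior carrier) = carrier
  frontier_eq : frontier carrier = ⋃ i, (side i).carrier
  disjoint_sides : ∀ i j, i ≠ j → Disjoint (side i).relInterior (side j).carrier

namespace SphericalPolygon

/-- A regular phase point of the billiard in `P`: a directed geodesic segment running inside `P`,
whose endpoints are interior points of sides, and which contains no corner.  It is recorded by its
initial unit tangent vector and its length, together with the sides where it begins and ends. -/
structure RegularChord (P : SphericalPolygon) where
  start : UnitTangent
  len : ℝ
  firstSide : Fin P.numSides
  lastSide : Fin P.numSides
  len_pos : 0 < len
  begin_mem : start.geod 0 ∈ (P.side firstSide).relInterior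
  inside : ∀ t ∈ Set.Ioo 0 len, start.geod t ∈ interior P.carrier
  end_mem : start.geod len ∈ (P.side lastSide).relInterior

/-- The billiard map on regular phase points, as a relation: `c'` is the image of `c` if `c'`
starts at the end of `c`, in the direction obtained from the final direction of `c` by the geodesic
reflection about the side on which `c` ends. -/
def BilliardNext (P : SphericalPolygon) (c c' : P.RegularChord) : Prop :=
  c'.start = (c.start.flow c.len).map (P.side c.lastSide).reflection

/-- `w` is the side code of the sequence of chords `x` : its letters are the sides on which the
chords begin, followed by the side on which the last chord ends. -/
def IsSideCode (P : SphericalPolygon) {n : ℕ} (x : Fin n → P.RegularChord)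
    (w : Fin (n + 1) → Fin P.numSides) : Prop :=
  ∀ k : Fin n, (x k).firstSide = w k.castSucc ∧ (x k).lastSide = w k.succ

/-- A regular `n`-segment billiard orbit. -/
def IsRegularOrbit (P : SphericalPolygon) {n : ℕ} (x : Fin n → P.RegularChord) : Prop :=
  ∀ k l : Fin n, (l : ℕ) = k + 1 → P.BilliardNext (x k) (x l)

/-- The words of length `n + 1` that are side codes of regular `n`-segment billiard orbits. -/
def sideWords (P : SphericalPolygon) (n : ℕ) : Set (Fin (n + 1) → Fin P.numSides) :=
  {w | ∃ x : Fin n → P.RegularChord, P.IsRegularOrbit x ∧ P.IsSideCode x w}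

/-- The side complexity of the billiard in `P`. -/
noncomputable def sideComplexity (P : SphericalPolygon) (n : ℕ) : ℕ := (P.sideWords n).ncard

end SphericalPolygon

/-- Subexponential growth: slower than every growing exponential. -/
def SubexponentialGrowth (f : ℕ → ℕ) : Prop :=
  ∀ ε : ℝ, 0 < ε → (fun n : ℕ => (f n : ℝ)) =o[atTop] fun n : ℕ => Real.exp (ε * n)

/-!
The pole of an oriented great circle turns the billiard into a piecewise isometry of the sphere of
poles: when a chord ends on the side `b`, the pole of the next chord is `-ρ_b` applied to the old
one, where `ρ_b` is the reflection in `b`.  Cut each side into four pieces, so that a transversal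
great circle meets each piece at most once, and call the endpoints of the pieces nodes.  The piece
where a chord ends is determined by the piece where it starts and by the signs of the inner products
of its pole with the nodes (`SphericalPolygon.RegularChord.end_piece_eq`).  Indeed all signs persist
along the segment between two poles with the same signs, hence so do the crossings with the pieces;
if the two chords ended in different pieces, then the cyclic order of three crossing points would
be reversed on the way, and two disjoint pieces would meet.  Thus side codes are coarser than the
itineraries of poles under a piecewise isometry whose domains are cut out by linear functionals.

Such piecewise isometries have subexponentially many itineraries
(`PiecewiseIsometry.exists_itin_bound`), in every dimension and uniformly over the rules that choose
the isometry from the signs; the rule may depend on the past.  This is proved by induction on the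
dimension.  For a fixed block length only finitely many functionals occur.  On a subset of the
unit sphere of small diameter, those that change sign are all small, so by compactness they do not
span the space (`PiecewiseIsometry.exists_le_abs_inner`), and projecting orthogonally to their span
gives a lower dimensional system with the same itineraries, few of them if the block is long.
The pieces of the small set are moved by isometries, hence remain small, and the estimate can be
iterated block after block.
-/

/-! ### Itineraries of piecewise isometries of a Euclidean space -/

namespace PiecewiseIsometry

open Module

variable {E : Type*} [NormedAddCommGroup E] [InnerProductSpace ℝ E]
  {ι B : Type*}

/-- The signs of the linear functionals `⟪v i, ·⟫` at the point `p`. -/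
noncomputable def signs (v : ι → E) (p : E) (i : ι) : SignType := SignType.sign (inner ℝ (v i) p)

/-- The isometry obtained by applying the isometries `R b` along a word, the first letter first. -/
def act (R : B → E ≃ₗᵢ[ℝ] E) : List B → E ≃ₗᵢ[ℝ] E
  | [] => LinearIsometryEquiv.refl ℝ E
  | b :: u => (R b).trans (act R u)

/-- The vector representing the functional `⟪v i, ·⟫`, evaluated after moving along the word `w`. -/
def pull (v : ι → E) (R : B → E ≃ₗᵢ[ℝ] E) (w : List B) (i : ι) : E := (act R w).symm (v i)

/-- The itinerary of length `n` of the point `p`.  The rule `F` chooses the next letter from the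
word read so far and the signs `signs v` at the current point, and the point then moves by the
isometry of that letter. -/
noncomputable def itin (v : ι → E) (R : B → E ≃ₗᵢ[ℝ] E) :
    (List B → (ι → SignType) → B) → ℕ → E → List B
  | _, 0, _ => []
  | F, n + 1, p =>
    F [] (signs v p) ::
      itin v R (fun u => F (F [] (signs v p) :: u)) n (R (F [] (signs v p)) p)

/-- The rule `F` uses, after the word `w`, only those functionals whose pullback along `w` is
represented by a vector of `U`. -/
def SupportedOn (v : ι → E) (R : B → E ≃ₗᵢ[ℝ] E) (U : Submodule ℝ E)
    (F : List B → (ι → SignType) → B) : Prop :=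
  ∀ w σ σ', (∀ i, pull v R w i ∈ U → σ i = σ' i) → F w σ = F w σ'

variable {v : ι → E} {R : B → E ≃ₗᵢ[ℝ] E}

theorem act_append (u w : List B) (p : E) : act R (u ++ w) p = act R w (act R u p) := by
  induction u generalizing p with
  | nil => rfl
  | cons b u ih => exact ih (R b p)

theorem pull_append (u w : List B) (i : ι) :
    pull v R (u ++ w) i = (act R u).symm (pull v R w i) := by
  unfold pull
  rw [LinearIsometryEquiv.symm_apply_eq, act_append, LinearIsometryEquiv.apply_symm_apply,
    LinearIsometryEquiv.apply_symm_apply]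

theorem signs_act (w : List B) (p : E) (i : ι) :
    signs v (act R w p) i = SignType.sign (inner ℝ (pull v R w i) p) := by
  unfold signs pull
  rw [← (act R w).inner_map_map ((act R w).symm (v i)), LinearIsometryEquiv.apply_symm_apply]

theorem norm_pull (w : List B) (i : ι) : ‖pull v R w i‖ = ‖v i‖ :=
  (act R w).symm.norm_map _

theorem length_itin (F : List B → (ι → SignType) → B) (n : ℕ) (p : E) :
    (itin v R F n p).length = n := by
  induction n generalizing F p with
  | zero => rfl
  | succ n ih => simp [itin, ih]

theorem itin_congr {F F' : List B → (ι → SignType) → B} {n : ℕ} {p q : E}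
    (h : ∀ w : List B, w.length < n →
      F w (signs v (act R w p)) = F' w (signs v (act R w q))) :
    itin v R F n p = itin v R F' n q := by
  induction n generalizing F F' p q with
  | zero => rfl
  | succ n ih =>
    have h0 : F [] (signs v p) = F' [] (signs v q) := h [] (Nat.succ_pos n)
    simp only [itin]
    rw [← h0]
    congr 1
    exact ih fun w hw => h (F [] (signs v p) :: w) (by simpa using hw)

theorem itin_add (F : List B → (ι → SignType) → B) (m n : ℕ) (p : E) :
    itin v R F (m + n) p = itin v R F m p ++
      itin v R (fun u => F (itin v R F m p ++ u)) n (act R (itin v R F m p) p) := by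
  induction m generalizing F p with
  | zero => simp [itin, act]
  | succ m ih =>
    rw [Nat.add_right_comm]
    simp only [itin, ih, List.cons_append]
    rfl

theorem itin_smul (F : List B → (ι → SignType) → B) (n : ℕ) {r : ℝ} (hr : 0 < r) (p : E) :
    itin v R F n (r • p) = itin v R F n p := by
  refine itin_congr fun w _ => ?_
  congr 1
  funext i
  rw [signs_act, signs_act, inner_smul_right, sign_mul, sign_pos hr, one_mul]

theorem SupportedOn.append {U : Submodule ℝ E} {F : List B → (ι → SignType) → B}
    (h : SupportedOn v R U F) (u : List B) :
    SupportedOn v R (U.map (act R u).toLinearEquiv.toLinearMap) (fun w => F (u ++ w)) := by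
  intro w σ σ' hσ
  refine h _ _ _ fun i hi => hσ i ?_
  rw [pull_append] at hi
  exact ⟨_, hi, (act R u).apply_symm_apply _⟩

theorem exists_finset_pull [Finite ι] [Finite B] (v : ι → E) (R : B → E ≃ₗᵢ[ℝ] E) (n : ℕ) :
    ∃ W : Finset E, ∀ w : List B, w.length < n → ∀ i, pull v R w i ∈ W := by
  have h1 : {w : List B | w.length < n}.Finite := List.finite_length_lt B n
  have h2 := (h1.prod (Set.finite_univ (α := ι))).image fun x => pull v R x.1 x.2
  exact ⟨h2.toFinset, fun w hw i => h2.mem_toFinset.2 ⟨(w, i), ⟨hw, Set.mem_univ _⟩, rfl⟩⟩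

/-- The vectors of a finite set cannot all be almost orthogonal to a unit vector of their span,
with one constant for all subsets of a given finite set. -/
theorem exists_le_abs_inner (W : Finset E) :
    ∃ δ : ℝ, 0 < δ ∧ ∀ S ⊆ W, ∀ p ∈ Submodule.span ℝ (S : Set E), ‖p‖ = 1 →
      ∃ a ∈ S, δ ≤ |inner ℝ a p| := by
  classical
  have key : ∀ S : Finset E, ∃ δ : ℝ, 0 < δ ∧ ∀ p ∈ Submodule.span ℝ (S : Set E), ‖p‖ = 1 →
      ∃ a ∈ S, δ ≤ |inner ℝ a p| := by
    intro S
    let K : Submodule ℝ E := Submodule.span ℝ (S : Set E)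
    have : FiniteDimensional ℝ K := FiniteDimensional.span_finset ℝ S
    have hc : IsCompact (Metric.sphere (0 : K) 1) := isCompact_sphere 0 1
    let f : K → ℝ := fun p => ∑ a ∈ S, |inner ℝ a (p : E)|
    have hf : Continuous f := by fun_prop
    have hpos : ∀ p ∈ Metric.sphere (0 : K) 1, 0 < f p := by
      intro p hp
      have h0 : 0 ≤ f p := Finset.sum_nonneg fun a _ => abs_nonneg _
      refine lt_of_le_of_ne h0 fun h => ?_
      have hz : ∀ a ∈ S, inner ℝ a (p : E) = 0 := by
        intro a ha
        have := (Finset.sum_eq_zero_iff_of_nonneg (fun a _ => abs_nonneg _)).1 h.symm a ha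
        exact abs_eq_zero.1 this
      have hp0 : (p : E) ∈ Kᗮ := by
        rw [Submodule.mem_orthogonal]
        intro u hu
        induction hu using Submodule.span_induction with
        | mem x hx => exact hz x hx
        | zero => simp
        | add x y _ _ hx hy => rw [inner_add_left, hx, hy, add_zero]
        | smul c x _ hx => rw [inner_smul_left, hx, mul_zero]
      have h1 : inner ℝ (p : E) (p : E) = 0 := (Submodule.mem_orthogonal _ _).1 hp0 _ p.2
      have h2 : p = 0 := Subtype.ext (inner_self_eq_zero.1 h1)
      rw [h2] at hp
      simp at hp
    obtain ⟨c, hc0, hcf⟩ : ∃ c : ℝ, 0 < c ∧ ∀ p ∈ Metric.sphere (0 : K) 1, c ≤ f p := by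
      rcases (Metric.sphere (0 : K) 1).eq_empty_or_nonempty with he | hne
      · exact ⟨1, one_pos, by simp [he]⟩
      · obtain ⟨p, hp, hmin⟩ := hc.exists_isMinOn hne hf.continuousOn
        exact ⟨f p, hpos p hp, fun q hq => hmin hq⟩
    refine ⟨c / (S.card + 1), by positivity, fun p hp hp1 => ?_⟩
    by_contra! hlt
    have h1 := hcf ⟨p, hp⟩ (by simpa using hp1)
    have h2 : f ⟨p, hp⟩ ≤ S.card • (c / (S.card + 1)) :=
      Finset.sum_le_card_nsmul _ _ _ fun a ha => (hlt a ha).le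
    have h3 : S.card • (c / ((S.card : ℝ) + 1)) < c := by
      rw [nsmul_eq_mul, mul_div_assoc', div_lt_iff₀ (by positivity)]
      nlinarith
    linarith
  choose δ hδ hS using key
  have hne : W.powerset.Nonempty := ⟨∅, by simp⟩
  refine ⟨W.powerset.inf' hne δ, ?_, fun S hSW p hp hp1 => ?_⟩
  · rw [Finset.lt_inf'_iff]
    exact fun S _ => hδ S
  · obtain ⟨a, ha, h⟩ := hS S p hp hp1
    exact ⟨a, ha, (Finset.inf'_le _ (Finset.mem_powerset.2 hSW)).trans h⟩

theorem abs_le_abs_sub_of_sign_ne {x y : ℝ} (h : SignType.sign y ≠ SignType.sign x) :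
    |x| ≤ |x - y| := by
  rcases lt_trichotomy x 0 with hx | hx | hx
  · have hy : 0 ≤ y := by
      by_contra! hy
      exact h (by rw [sign_neg hx, sign_neg hy])
    rw [abs_of_neg hx, abs_of_neg (by linarith)]
    linarith
  · simp [hx]
  · have hy : y ≤ 0 := by
      by_contra! hy
      exact h (by rw [sign_pos hx, sign_pos hy])
    rw [abs_of_pos hx, abs_of_pos (by linarith)]
    linarith

/-- For every `ε > 0` the itineraries of the points of a subspace `U` of dimension at most `k` grow
at rate at most `ε`, under rules supported on `U`, with a constant that depends neither on `U` nor
on the rule.  The uniformity is what allows passing from one block of letters to the next. -/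
def GrowthBound (v : ι → E) (R : B → E ≃ₗᵢ[ℝ] E) (k : ℕ) : Prop :=
  ∀ ε : ℝ, 0 < ε → ∃ C : ℝ, ∀ U : Submodule ℝ E, finrank ℝ U ≤ k →
    ∀ F : List B → (ι → SignType) → B, SupportedOn v R U F → ∀ n : ℕ,
      ∃ L : Finset (List B), (L.card : ℝ) ≤ C * Real.exp (ε * n) ∧
        ∀ p ∈ U, itin v R F n p ∈ L

variable [FiniteDimensional ℝ E]

/-- On a set of small diameter the functionals that change sign span a proper subspace `U'` of `U`,
so the itineraries there are itineraries of the orthogonal projections to `U'` under the rule in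
which the signs of the other functionals are frozen. -/
theorem exists_lower_dimensional_model {U : Submodule ℝ E} {F : List B → (ι → SignType) → B}
    (hF : SupportedOn v R U F) {n : ℕ} {W : Finset E}
    (hW : ∀ w : List B, w.length < n → ∀ i, pull v R w i ∈ W) (hv : ∀ i, ‖v i‖ ≤ 1)
    {δ : ℝ} (hδ : ∀ S ⊆ W, ∀ p ∈ Submodule.span ℝ (S : Set E), ‖p‖ = 1 →
      ∃ a ∈ S, δ ≤ |inner ℝ a p|)
    {A : Set E} (hAU : A ⊆ U) (hA1 : ∀ p ∈ A, ‖p‖ = 1)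
    (hA : ∀ p ∈ A, ∀ q ∈ A, ‖p - q‖ < δ) (hne : A.Nonempty) :
    ∃ (U' : Submodule ℝ E) (F' : List B → (ι → SignType) → B),
      finrank ℝ U' < finrank ℝ U ∧ SupportedOn v R U' F' ∧
      ∀ p ∈ A, ∃ q ∈ U', itin v R F n p = itin v R F' n q := by
  classical
  obtain ⟨p₀, hp₀⟩ := hne
  -- A functional `a ∈ S` changes sign on `A`, so `|⟪a, p₀⟫|` is less than the diameter bound `δ`.
  let S : Finset E := W.filter fun a => a ∈ U ∧ (∃ w : List B, ∃ i, pull v R w i = a) ∧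
    ∃ p ∈ A, SignType.sign (inner ℝ a p) ≠ SignType.sign (inner ℝ a p₀)
  let U' : Submodule ℝ E := Submodule.span ℝ (S : Set E)
  have hle : U' ≤ U := Submodule.span_le.2 fun a ha => (Finset.mem_filter.1 ha).2.1
  have hp₀U' : p₀ ∉ U' := by
    intro hmem
    obtain ⟨a, ha, hδa⟩ := hδ S (Finset.filter_subset _ _) p₀ hmem (hA1 p₀ hp₀)
    obtain ⟨-, -, ⟨w, i, rfl⟩, p, hp, hsign⟩ := Finset.mem_filter.1 ha
    have h1 := abs_le_abs_sub_of_sign_ne hsign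
    rw [← inner_sub_right] at h1
    have h2 := abs_real_inner_le_norm (pull v R w i) (p₀ - p)
    rw [norm_pull] at h2
    have h3 := hA p₀ hp₀ p hp
    have h4 : ‖v i‖ * ‖p₀ - p‖ ≤ ‖p₀ - p‖ :=
      mul_le_of_le_one_left (norm_nonneg _) (hv i)
    linarith
  refine ⟨U', fun w σ => F w fun i => if pull v R w i ∈ S then σ i else
      SignType.sign (inner ℝ (pull v R w i) p₀), ?_, ?_, fun p hp => ?_⟩
  · exact Submodule.finrank_lt_finrank_of_lt
      (lt_of_le_of_ne hle fun h => hp₀U' (h ▸ hAU hp₀))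
  · intro w σ σ' hσ
    dsimp only
    congr 1
    funext i
    split_ifs with hi
    · exact hσ i (Submodule.subset_span hi)
    · rfl
  · refine ⟨U'.starProjection p, U'.starProjection_apply_mem p, itin_congr fun w hw => ?_⟩
    refine hF _ _ _ fun i hi => ?_
    rw [signs_act, signs_act]
    split_ifs with hS
    · congr 1
      have h1 := U'.starProjection_inner_eq_zero p _ (Submodule.subset_span hS)
      rw [inner_sub_left, sub_eq_zero] at h1
      rw [real_inner_comm, h1, real_inner_comm]
    · by_contra hne
      exact hS (Finset.mem_filter.2 ⟨hW w hw i, hi, ⟨w, i, rfl⟩, p, hp, hne⟩)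

variable [Finite ι] [Finite B]

/-- On sets of diameter less than `δ` the itineraries grow at rate `ε`, along the multiples of some
block length `m`: within each block the lower dimensional bound applies, and isometries do not
increase the diameter. -/
theorem GrowthBound.exists_blocks (hv : ∀ i, ‖v i‖ ≤ 1) {k : ℕ} (hk : GrowthBound v R k)
    {ε : ℝ} (hε : 0 < ε) :
    ∃ m : ℕ, 0 < m ∧ ∃ δ : ℝ, 0 < δ ∧ ∀ (j : ℕ) (U : Submodule ℝ E), finrank ℝ U ≤ k + 1 →
      ∀ F : List B → (ι → SignType) → B, SupportedOn v R U F →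
      ∀ A : Set E, A ⊆ U → (∀ p ∈ A, ‖p‖ = 1) → (∀ p ∈ A, ∀ q ∈ A, ‖p - q‖ < δ) →
      ∃ L : Finset (List B), (L.card : ℝ) ≤ Real.exp (ε * m) ^ j ∧
        ∀ p ∈ A, itin v R F (j * m) p ∈ L := by
  classical
  obtain ⟨C, hC⟩ := hk (ε / 2) (half_pos hε)
  obtain ⟨m, hm0, hm⟩ : ∃ m : ℕ, 0 < m ∧ C * Real.exp (ε / 2 * m) ≤ Real.exp (ε * m) := by
    obtain ⟨m, hm⟩ := exists_nat_gt (max 0 (Real.log (max C 1) / (ε / 2)))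
    have h0 : (0 : ℝ) < m := (le_max_left _ _).trans_lt hm
    have h1 := (le_max_right _ _).trans_lt hm
    rw [div_lt_iff₀ (half_pos hε)] at h1
    refine ⟨m, by exact_mod_cast h0, ?_⟩
    have h2 : C ≤ Real.exp (ε / 2 * m) := by
      refine (le_max_left C 1).trans ?_
      rw [← Real.log_le_iff_le_exp (by positivity)]
      linarith
    calc C * Real.exp (ε / 2 * m) ≤ Real.exp (ε / 2 * m) * Real.exp (ε / 2 * m) := by gcongr
      _ = Real.exp (ε * m) := by rw [← Real.exp_add]; ring_nf
  obtain ⟨W, hW⟩ := exists_finset_pull v R m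
  obtain ⟨δ, hδ0, hδ⟩ := exists_le_abs_inner W
  refine ⟨m, hm0, δ, hδ0, fun j => ?_⟩
  induction j with
  | zero =>
    intro U _ F _ A _ _ _
    exact ⟨{[]}, by simp, fun p _ => by simp [itin]⟩
  | succ j ih =>
    intro U hU F hF A hAU hA1 hA
    obtain rfl | hne := A.eq_empty_or_nonempty
    · exact ⟨∅, by simp; positivity, by simp⟩
    obtain ⟨L₁, hL₁, hL₁A⟩ : ∃ L : Finset (List B), (L.card : ℝ) ≤ Real.exp (ε * m) ∧
        ∀ p ∈ A, itin v R F m p ∈ L := by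
      obtain ⟨U', F', hU', hF', hit⟩ :=
        exists_lower_dimensional_model hF hW hv hδ hAU hA1 hA hne
      obtain ⟨L, hL, hLU⟩ := hC U' (by omega) F' hF' m
      refine ⟨L, hL.trans hm, fun p hp => ?_⟩
      obtain ⟨q, hq, h⟩ := hit p hp
      exact h ▸ hLU q hq
    have hstep : ∀ u : List B, ∃ L : Finset (List B), (L.card : ℝ) ≤ Real.exp (ε * m) ^ j ∧
        ∀ p ∈ act R u '' A, itin v R (fun w => F (u ++ w)) (j * m) p ∈ L := by
      intro u
      refine ih (U.map (act R u).toLinearEquiv.toLinearMap) ?_ _ (hF.append u) _ ?_ ?_ ?_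
      · rwa [LinearEquiv.finrank_map_eq]
      · rintro _ ⟨p, hp, rfl⟩
        exact ⟨p, hAU hp, rfl⟩
      · rintro _ ⟨p, hp, rfl⟩
        rw [LinearIsometryEquiv.norm_map, hA1 p hp]
      · rintro _ ⟨p, hp, rfl⟩ _ ⟨q, hq, rfl⟩
        rw [← map_sub, LinearIsometryEquiv.norm_map]
        exact hA p hp q hq
    choose L₂ hL₂ hL₂A using hstep
    refine ⟨L₁.biUnion fun u => (L₂ u).image (u ++ ·), ?_, fun p hp => ?_⟩
    · have h1 : (L₁.biUnion fun u => (L₂ u).image (u ++ ·)).card ≤ ∑ u ∈ L₁, (L₂ u).card :=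
        Finset.card_biUnion_le.trans (Finset.sum_le_sum fun u _ => Finset.card_image_le)
      calc ((L₁.biUnion fun u => (L₂ u).image (u ++ ·)).card : ℝ)
          ≤ ((∑ u ∈ L₁, (L₂ u).card : ℕ) : ℝ) := by exact_mod_cast h1
        _ = ∑ u ∈ L₁, ((L₂ u).card : ℝ) := by push_cast; rfl
        _ ≤ L₁.card • Real.exp (ε * m) ^ j := Finset.sum_le_card_nsmul _ _ _ fun u _ => hL₂ u
        _ = L₁.card * Real.exp (ε * m) ^ j := nsmul_eq_mul _ _
        _ ≤ Real.exp (ε * m) * Real.exp (ε * m) ^ j := by gcongr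
        _ = Real.exp (ε * m) ^ (j + 1) := (pow_succ' _ _).symm
    · rw [Nat.succ_mul, Nat.add_comm, itin_add]
      refine Finset.mem_biUnion.2 ⟨_, hL₁A p hp, Finset.mem_image.2 ⟨_, ?_, rfl⟩⟩
      exact hL₂A _ _ ⟨p, hp, rfl⟩

theorem GrowthBound.succ (hv : ∀ i, ‖v i‖ ≤ 1) {k : ℕ} (hk : GrowthBound v R k) :
    GrowthBound v R (k + 1) := by
  classical
  intro ε hε
  obtain ⟨m, hm, δ, hδ, hblock⟩ := hk.exists_blocks hv hε
  obtain ⟨t, -, htf, ht⟩ := Metric.totallyBounded_iff.1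
    (isCompact_sphere (0 : E) 1).totallyBounded (δ / 2) (half_pos hδ) |>.imp
      fun t h => (⟨trivial, h.1, h.2⟩ : True ∧ _ ∧ _)
  refine ⟨(htf.toFinset.card + 1) * Real.exp (ε * m), fun U hU F hF n => ?_⟩
  -- The blocks cover slightly more than `n` letters; the surplus is cut off by `List.take`.
  let j := n / m + 1
  have hjn : n ≤ j * m := by
    have := Nat.div_add_mod n m
    have := Nat.mod_lt n hm
    simp only [j, Nat.add_mul, Nat.mul_comm (n / m) m]
    omega
  have hloc : ∀ c : E, ∃ L : Finset (List B), (L.card : ℝ) ≤ Real.exp (ε * m) ^ j ∧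
      ∀ p ∈ (U : Set E) ∩ Metric.sphere 0 1 ∩ Metric.ball c (δ / 2),
        itin v R F (j * m) p ∈ L := by
    intro c
    refine hblock j U hU F hF _ (fun p hp => hp.1.1) (fun p hp => by simpa using hp.1.2) ?_
    intro p hp q hq
    have h1 := Metric.mem_ball.1 hp.2
    have h2 := Metric.mem_ball'.1 hq.2
    rw [← dist_eq_norm]
    linarith [dist_triangle p c q]
  choose L hL hLU using hloc
  -- The origin is the only point that cannot be rescaled to the unit sphere.
  let L' : Finset (List B) := insert (itin v R F n 0)
    ((htf.toFinset.biUnion L).image (List.take n))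
  have htake : ∀ p, itin v R F n p = (itin v R F (j * m) p).take n := by
    intro p
    obtain ⟨r, hr⟩ := Nat.exists_eq_add_of_le hjn
    rw [hr, itin_add]
    exact (List.take_left' (length_itin F n p)).symm
  refine ⟨L', ?_, fun p hp => ?_⟩
  · have h1 : L'.card ≤ (∑ c ∈ htf.toFinset, (L c).card) + 1 :=
      (Finset.card_insert_le _ _).trans
        (Nat.succ_le_succ (Finset.card_image_le.trans Finset.card_biUnion_le))
    have h2 : Real.exp (ε * m) ^ j ≤ Real.exp (ε * m) * Real.exp (ε * n) := by
      rw [← Real.exp_nat_mul, ← Real.exp_add, Real.exp_le_exp]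
      have h3 : ((n / m : ℕ) : ℝ) * m ≤ n := by exact_mod_cast Nat.div_mul_le_self n m
      simp only [j]
      push_cast
      nlinarith
    have h4 : (1 : ℝ) ≤ Real.exp (ε * m) ^ j := one_le_pow₀ (Real.one_le_exp (by positivity))
    calc (L'.card : ℝ) ≤ (((∑ c ∈ htf.toFinset, (L c).card) + 1 : ℕ) : ℝ) := by exact_mod_cast h1
      _ = (∑ c ∈ htf.toFinset, ((L c).card : ℝ)) + 1 := by push_cast; rfl
      _ ≤ htf.toFinset.card • Real.exp (ε * m) ^ j + Real.exp (ε * m) ^ j :=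
        add_le_add (Finset.sum_le_card_nsmul _ _ _ fun c _ => hL c) h4
      _ = (htf.toFinset.card + 1) * Real.exp (ε * m) ^ j := by rw [nsmul_eq_mul]; ring
      _ ≤ (htf.toFinset.card + 1) * (Real.exp (ε * m) * Real.exp (ε * n)) := by gcongr
      _ = _ := by ring
  · rcases eq_or_ne p 0 with rfl | hp0
    · exact Finset.mem_insert_self _ _
    · have hn : 0 < ‖p‖⁻¹ := inv_pos.2 (norm_pos_iff.2 hp0)
      have hs : ‖p‖⁻¹ • p ∈ Metric.sphere (0 : E) 1 := by
        rw [mem_sphere_zero_iff_norm]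
        exact norm_smul_inv_norm (𝕜 := ℝ) hp0
      obtain ⟨c, hc, hpc⟩ := Set.mem_iUnion₂.1 (ht hs)
      refine Finset.mem_insert_of_mem (Finset.mem_image.2 ⟨itin v R F (j * m) (‖p‖⁻¹ • p), ?_, ?_⟩)
      · exact Finset.mem_biUnion.2 ⟨c, htf.mem_toFinset.2 hc,
          hLU c _ ⟨⟨U.smul_mem _ hp, hs⟩, hpc⟩⟩
      · rw [← htake, itin_smul F n hn]

theorem growthBound (v : ι → E) (R : B → E ≃ₗᵢ[ℝ] E) (hv : ∀ i, ‖v i‖ ≤ 1) (k : ℕ) :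
    GrowthBound v R k := by
  induction k with
  | zero =>
    intro ε hε
    refine ⟨1, fun U hU F _ n => ⟨{itin v R F n 0}, ?_, fun p hp => ?_⟩⟩
    · simpa using Real.one_le_exp (by positivity : 0 ≤ ε * n)
    · have : U = ⊥ := Submodule.finrank_eq_zero.1 (Nat.le_zero.1 hU)
      rw [this, Submodule.mem_bot] at hp
      simp [hp]
  | succ k ih => exact ih.succ hv

/-- A piecewise isometry whose pieces are cut out by linear functionals has subexponentially many
itineraries, uniformly over the rules that choose the isometry from the signs. -/
theorem exists_itin_bound (v : ι → E) (R : B → E ≃ₗᵢ[ℝ] E) (hv : ∀ i, ‖v i‖ ≤ 1)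
    {ε : ℝ} (hε : 0 < ε) :
    ∃ C : ℝ, ∀ (F : List B → (ι → SignType) → B) (n : ℕ),
      ∃ L : Finset (List B), (L.card : ℝ) ≤ C * Real.exp (ε * n) ∧ ∀ p, itin v R F n p ∈ L := by
  obtain ⟨C, hC⟩ := growthBound v R hv (finrank ℝ E) ε hε
  refine ⟨C, fun F n => ?_⟩
  obtain ⟨L, hL, h⟩ := hC ⊤ (finrank_top ℝ E).le F
    (fun w σ σ' hσ => congrArg (F w) (funext fun i => hσ i Submodule.mem_top)) n
  exact ⟨L, hL, fun p => h p Submodule.mem_top⟩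

end PiecewiseIsometry

/-! ### Poles of oriented great circles -/

/-- The cross product on Euclidean three-space. -/
noncomputable def cross (x y : E3) : E3 :=
  !₂[x 1 * y 2 - x 2 * y 1, x 2 * y 0 - x 0 * y 2, x 0 * y 1 - x 1 * y 0]

theorem inner_eq_sum_three (x y : E3) : inner ℝ x y = x 0 * y 0 + x 1 * y 1 + x 2 * y 2 := by
  simp only [PiLp.inner_apply, Fin.sum_univ_three, RCLike.inner_apply, conj_trivial]
  ring

theorem inner_cross_self_left (x y : E3) : inner ℝ x (cross x y) = 0 := by
  simp [inner_eq_sum_three, cross]; ring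

theorem inner_cross_self_right (x y : E3) : inner ℝ y (cross x y) = 0 := by
  simp [inner_eq_sum_three, cross]; ring

theorem inner_cross_cross (x y z w : E3) :
    inner ℝ (cross x y) (cross z w) =
      inner ℝ x z * inner ℝ y w - inner ℝ x w * inner ℝ y z := by
  simp [inner_eq_sum_three, cross]; ring

theorem cross_cross_eq (x y z : E3) :
    cross (cross x y) z = inner ℝ x z • y - inner ℝ y z • x := by
  ext i; fin_cases i <;> simp [inner_eq_sum_three, cross] <;> ring

theorem cross_swap (x y : E3) : cross x y = -cross y x := by
  ext i; fin_cases i <;> simp [cross] <;> ring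

theorem cross_comb (a b c d : ℝ) (x y : E3) :
    cross (a • x + b • y) (c • x + d • y) = (a * d - b * c) • cross x y := by
  ext i; fin_cases i <;> simp [cross] <;> ring

theorem comb_cross (a b : ℝ) (x y z : E3) :
    cross (a • x + b • y) z = a • cross x z + b • cross y z := by
  ext i; fin_cases i <;> simp [cross] <;> ring

namespace UnitTangent

theorem coe_geod (u : UnitTangent) (t : ℝ) :
    (u.geod t : E3) = Real.cos t • u.pt + Real.sin t • u.dir := rfl

theorem norm_geod (u : UnitTangent) (t : ℝ) : ‖(u.geod t : E3)‖ = 1 :=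
  mem_sphere_zero_iff_norm.1 (u.geod t).2

theorem inner_pt_self (u : UnitTangent) : inner ℝ u.pt u.pt = 1 := by
  rw [real_inner_self_eq_norm_sq, u.norm_pt, one_pow]

theorem inner_dir_self (u : UnitTangent) : inner ℝ u.dir u.dir = 1 := by
  rw [real_inner_self_eq_norm_sq, u.norm_dir, one_pow]

theorem inner_dir_pt (u : UnitTangent) : inner ℝ u.dir u.pt = 0 := by
  rw [real_inner_comm, u.inner_eq_zero]

/-- The pole of the oriented great circle along a unit tangent vector. -/
noncomputable def pole (u : UnitTangent) : E3 := cross u.pt u.dir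

theorem inner_pole_self (u : UnitTangent) : inner ℝ u.pole u.pole = 1 := by
  rw [pole, inner_cross_cross, u.inner_pt_self, u.inner_dir_self, u.inner_eq_zero]
  ring

theorem inner_geod_pole (u : UnitTangent) (t : ℝ) : inner ℝ (u.geod t : E3) u.pole = 0 := by
  rw [coe_geod, inner_add_left, inner_smul_left, inner_smul_left, pole, inner_cross_self_left,
    inner_cross_self_right]
  simp

/-- The foot point, the direction and the pole form an orthonormal basis. -/
theorem eq_sum (u : UnitTangent) (w : E3) :
    w = inner ℝ u.pt w • u.pt + inner ℝ u.dir w • u.dir + inner ℝ u.pole w • u.pole := by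
  have h1 : cross u.dir u.pole = u.pt := by
    rw [cross_swap, pole, cross_cross_eq, u.inner_eq_zero, u.inner_dir_self]; simp
  have h2 : cross u.pt u.pole = -u.dir := by
    rw [cross_swap, pole, cross_cross_eq, u.inner_pt_self, u.inner_dir_pt]; simp
  have h3 : cross u.pole w = (-inner ℝ u.dir w) • u.pt + inner ℝ u.pt w • u.dir := by
    rw [pole, cross_cross_eq]; module
  have h4 : cross (cross u.pole w) u.pole = w - inner ℝ u.pole w • u.pole := by
    rw [cross_cross_eq, u.inner_pole_self, real_inner_comm, one_smul]
  rw [h3, comb_cross, h1, h2] at h4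
  rw [← sub_eq_iff_eq_add, ← h4]
  module

theorem cross_geod (u : UnitTangent) (s t : ℝ) :
    cross (u.geod s) (u.geod t) = Real.sin (t - s) • u.pole := by
  rw [coe_geod, coe_geod, cross_comb, Real.sin_sub, pole]
  congr 1; ring

theorem inner_geod_geod (u : UnitTangent) (s t : ℝ) :
    inner ℝ (u.geod s : E3) (u.geod t : E3) = Real.cos (t - s) := by
  simp only [coe_geod, inner_add_left, inner_add_right, real_inner_smul_left,
    real_inner_smul_right, u.inner_pt_self, u.inner_dir_self, u.inner_eq_zero, u.inner_dir_pt,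
    Real.cos_sub]
  ring

theorem eq_of_geod_eq (u : UnitTangent) {s t : ℝ} (h : (u.geod s : E3) = u.geod t)
    (h1 : -(2 * Real.pi) < t - s) (h2 : t - s < 2 * Real.pi) : s = t := by
  have h3 := u.inner_geod_geod s t
  rw [← h, real_inner_self_eq_norm_sq, norm_geod, one_pow] at h3
  have h4 := (Real.cos_eq_one_iff_of_lt_of_lt h1 h2).1 h3.symm
  linarith

theorem exists_geod_eq (u : UnitTangent) {w : E3} (hw : ‖w‖ = 1) (h : inner ℝ w u.pole = 0) :
    ∃ t, 0 ≤ t ∧ t < 2 * Real.pi ∧ w = u.geod t := by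
  have hsum := u.eq_sum w
  rw [real_inner_comm w u.pole, h, zero_smul, add_zero] at hsum
  set a : ℝ := inner ℝ u.pt w
  set b : ℝ := inner ℝ u.dir w
  have hab : a ^ 2 + b ^ 2 = 1 := by
    have h1 : inner ℝ w w = (1 : ℝ) := by rw [real_inner_self_eq_norm_sq, hw, one_pow]
    rw [hsum] at h1
    simp only [inner_add_left, inner_add_right, real_inner_smul_left,
      real_inner_smul_right, u.inner_pt_self, u.inner_dir_self, u.inner_eq_zero,
      u.inner_dir_pt] at h1
    linarith
  have hz : ‖(⟨a, b⟩ : ℂ)‖ = 1 := by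
    rw [Complex.norm_def, Complex.normSq_mk, ← sq, ← sq, hab, Real.sqrt_one]
  have hz0 : (⟨a, b⟩ : ℂ) ≠ 0 := by
    intro h0
    rw [h0, norm_zero] at hz
    exact zero_ne_one hz
  have hpi := Real.two_pi_pos
  let θ := Complex.arg ⟨a, b⟩
  have hc : Real.cos θ = a := by rw [Complex.cos_arg hz0, hz, div_one]
  have hs : Real.sin θ = b := by rw [Complex.sin_arg, hz, div_one]
  refine ⟨toIcoMod hpi 0 θ, left_le_toIcoMod hpi 0 θ, ?_, ?_⟩
  · simpa using toIcoMod_lt_right hpi 0 θ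
  · rw [coe_geod, toIcoMod, zsmul_eq_mul, Real.cos_sub_int_mul_two_pi,
      Real.sin_sub_int_mul_two_pi, hc, hs]
    exact hsum

theorem pole_flow (u : UnitTangent) (t : ℝ) : (u.flow t).pole = u.pole := by
  change cross (Real.cos t • u.pt + Real.sin t • u.dir)
    ((-Real.sin t) • u.pt + Real.cos t • u.dir) = u.pole
  rw [cross_comb, pole]
  have : Real.cos t * Real.cos t - Real.sin t * -Real.sin t = 1 := by
    linarith [Real.cos_sq_add_sin_sq t]
  rw [this, one_smul]

theorem geod_flow (u : UnitTangent) (s t : ℝ) : ((u.flow s).geod t : E3) = u.geod (s + t) := by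
  change Real.cos t • (Real.cos s • u.pt + Real.sin s • u.dir) +
    Real.sin t • ((-Real.sin s) • u.pt + Real.cos s • u.dir) = _
  rw [coe_geod, Real.cos_add, Real.sin_add]
  module

/-- A great circle orthogonal to the pole of `u` is the great circle along `u`, with one of its two
orientations. -/
theorem geod_eq_geod_of_inner_pole_eq_zero {u e : UnitTangent} {L t : ℝ}
    (h : (u.geod L : E3) = e.geod t) (hpt : inner ℝ e.pt u.pole = 0)
    (hdir : inner ℝ e.dir u.pole = 0) :
    ∃ σ : ℝ, |σ| = 1 ∧ ∀ r, (u.geod (L + r) : E3) = e.geod (t + σ * r) := by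
  have h0 : (u.flow L).pt = (e.flow t).pt := h
  have hd : inner ℝ (u.flow L).pole (e.flow t).dir = 0 := by
    rw [pole_flow, real_inner_comm]
    change inner ℝ ((-Real.sin t) • e.pt + Real.cos t • e.dir) u.pole = 0
    rw [inner_add_left, inner_smul_left, inner_smul_left, hpt, hdir]
    simp
  have hsum := (u.flow L).eq_sum (e.flow t).dir
  rw [hd, h0, (e.flow t).inner_eq_zero, zero_smul, zero_smul, zero_add, add_zero] at hsum
  set σ : ℝ := inner ℝ (u.flow L).dir (e.flow t).dir
  have hσ : |σ| = 1 := by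
    have := congrArg norm hsum
    rw [norm_smul, (e.flow t).norm_dir, (u.flow L).norm_dir, mul_one, Real.norm_eq_abs] at this
    exact this.symm
  refine ⟨σ, hσ, fun r => ?_⟩
  rw [← geod_flow, ← geod_flow, coe_geod, coe_geod, h0, hsum]
  rcases eq_or_eq_neg_of_abs_eq hσ with h1 | h1 <;> rw [h1] <;> simp

theorem continuous_geod (u : UnitTangent) : Continuous fun t => (u.geod t : E3) := by
  unfold geod
  fun_prop

end UnitTangent

namespace GeodesicArc

/-- The pole of the reflection is obtained by the rotation by `π` about the axis of the great
circle, which is minus the reflection. -/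
theorem pole_map_reflection (a : GeodesicArc) (u : UnitTangent) :
    (u.map a.reflection).pole = -a.reflection u.pole := by
  have hrefl : ∀ w : E3, a.reflection w = w - (2 * inner ℝ a.frame.pole w) • a.frame.pole := by
    intro w
    let K := Submodule.span ℝ {a.frame.pt, a.frame.dir}
    have hpole : a.frame.pole ∈ Kᗮ := by
      rw [Submodule.mem_orthogonal]
      intro x hx
      obtain ⟨c, d, rfl⟩ := Submodule.mem_span_pair.1 hx
      rw [inner_add_left, inner_smul_left, inner_smul_left, UnitTangent.pole,
        inner_cross_self_left, inner_cross_self_right]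
      simp
    have h1 : K.reflection a.frame.pole = -a.frame.pole :=
      Submodule.reflection_mem_subspace_orthogonalComplement_eq_neg hpole
    have h2 : K.reflection a.frame.pt = a.frame.pt :=
      Submodule.reflection_mem_subspace_eq_self (Submodule.subset_span (by simp))
    have h3 : K.reflection a.frame.dir = a.frame.dir :=
      Submodule.reflection_mem_subspace_eq_self (Submodule.subset_span (by simp))
    change K.reflection w = _
    have hw := a.frame.eq_sum w
    conv_lhs => rw [hw]
    rw [map_add, map_add, map_smul, map_smul, map_smul, h1, h2, h3]
    conv_rhs => enter [1]; rw [hw]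
    module
  set n := a.frame.pole
  have hnn : n 0 * n 0 + n 1 * n 1 + n 2 * n 2 = 1 := by
    rw [← inner_eq_sum_three]; exact a.frame.inner_pole_self
  change cross (a.reflection u.pt) (a.reflection u.dir) = _
  rw [hrefl, hrefl, hrefl]
  have h1 : cross (u.pt - (2 * inner ℝ n u.pt) • n) (u.dir - (2 * inner ℝ n u.dir) • n) =
      cross u.pt u.dir + (2 : ℝ) • cross (cross u.pole n) n := by
    rw [UnitTangent.pole, cross_cross_eq u.pt u.dir n, real_inner_comm n, real_inner_comm n]
    ext i; fin_cases i <;> simp [cross] <;> ring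
  rw [h1, cross_cross_eq, ← UnitTangent.pole, inner_eq_sum_three n n, hnn,
    real_inner_comm n u.pole]
  module

end GeodesicArc

/-- Twice the signed area, as seen from `n`, of the triangle with vertices `a`, `b`, `c`.  For three
points on the great circle with pole `n` it tells their cyclic order. -/
noncomputable def signedArea (n a b c : E3) : ℝ :=
  inner ℝ n (cross a b) + inner ℝ n (cross b c) + inner ℝ n (cross c a)

theorem signedArea_swap (n a b c : E3) : signedArea n a b c = -signedArea n a c b := by
  unfold signedArea
  rw [cross_swap a b, cross_swap b c, cross_swap c a]
  simp only [inner_neg_right]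
  ring

theorem signedArea_geod (u : UnitTangent) (s t : ℝ) :
    signedArea u.pole (u.geod 0) (u.geod s) (u.geod t) =
      4 * Real.sin (s / 2) * Real.sin ((t - s) / 2) * Real.sin (t / 2) := by
  unfold signedArea
  simp only [UnitTangent.cross_geod, inner_smul_right, u.inner_pole_self]
  obtain ⟨x, rfl⟩ : ∃ x, s = 2 * x := ⟨s / 2, by ring⟩
  obtain ⟨y, rfl⟩ : ∃ y, t = 2 * y := ⟨t / 2, by ring⟩
  have e1 : 2 * x / 2 = x := by ring
  have e2 : (2 * y - 2 * x) / 2 = y - x := by ring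
  have e3 : 2 * y / 2 = y := by ring
  have e4 : 2 * y - 2 * x = 2 * (y - x) := by ring
  have e5 : 0 - 2 * y = -(2 * y) := by ring
  rw [e1, e2, e3, e4, e5, sub_zero, Real.sin_neg, Real.sin_two_mul, Real.sin_two_mul,
    Real.sin_two_mul, Real.sin_sub, Real.cos_sub]
  have hx := Real.sin_sq_add_cos_sq x
  have hy := Real.sin_sq_add_cos_sq y
  linear_combination (2 * Real.sin x * Real.cos x) * (-hy) +
    (2 * Real.sin y * Real.cos y) * hx

theorem eq_or_eq_of_signedArea_eq_zero {n a b c : E3} (hn : n ≠ 0) (ha : ‖a‖ = 1) (hb : ‖b‖ = 1)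
    (hc : ‖c‖ = 1) (han : inner ℝ a n = 0) (hbn : inner ℝ b n = 0) (hcn : inner ℝ c n = 0)
    (h : signedArea n a b c = 0) : a = b ∨ b = c ∨ c = a := by
  have hn0 : ‖n‖ ≠ 0 := norm_ne_zero_iff.2 hn
  let m : E3 := ‖n‖⁻¹ • n
  have hm : ‖m‖ = 1 := norm_smul_inv_norm (𝕜 := ℝ) hn
  have hmm : inner ℝ m m = (1 : ℝ) := by rw [real_inner_self_eq_norm_sq, hm, one_pow]
  have haa : inner ℝ a a = (1 : ℝ) := by rw [real_inner_self_eq_norm_sq, ha, one_pow]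
  have hm0 : ∀ {x : E3}, inner ℝ x n = 0 → inner ℝ x m = 0 := fun hx => by
    rw [inner_smul_right, hx, mul_zero]
  have ham : inner ℝ m a = 0 := by rw [real_inner_comm]; exact hm0 han
  let u : UnitTangent :=
    { pt := a
      dir := cross m a
      norm_pt := ha
      norm_dir := by
        have : ‖cross m a‖ ^ 2 = 1 := by
          rw [← real_inner_self_eq_norm_sq, inner_cross_cross, hmm, haa, ham]; ring
        nlinarith [norm_nonneg (cross m a)]
      inner_eq_zero := inner_cross_self_right m a }
  have hu : u.pole = m := by
    change cross a (cross m a) = m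
    rw [cross_swap, cross_cross_eq, ham, haa]; simp
  have h0 : (u.geod 0 : E3) = a := by simp [UnitTangent.coe_geod, u]
  obtain ⟨s, hs0, hs2, rfl⟩ := u.exists_geod_eq hb (hu ▸ hm0 hbn)
  obtain ⟨t, ht0, ht2, rfl⟩ := u.exists_geod_eq hc (hu ▸ hm0 hcn)
  have harea : signedArea u.pole (u.geod 0) (u.geod s) (u.geod t) = 0 := by
    rw [hu, h0]
    have : signedArea m a (u.geod s) (u.geod t) =
        ‖n‖⁻¹ * signedArea n a (u.geod s) (u.geod t) := by
      simp only [signedArea, m, real_inner_smul_left]; ring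
    rw [this, h, mul_zero]
  rw [signedArea_geod] at harea
  have hzero : ∀ {x : ℝ}, -(2 * Real.pi) < x → x < 2 * Real.pi → Real.sin (x / 2) = 0 →
      x = 0 := by
    intro x h1 h2 h3
    have := (Real.sin_eq_zero_iff_of_lt_of_lt (by linarith) (by linarith)).1 h3
    linarith
  have hpi := Real.pi_pos
  rcases mul_eq_zero.1 harea with h1 | h1
  · rcases mul_eq_zero.1 h1 with h2 | h2
    · left
      rw [hzero (by linarith) hs2 (by simpa using h2), h0]
    · right; left
      rw [sub_eq_zero.1 (hzero (by linarith) (by linarith) h2)]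
  · right; right
    rw [hzero (by linarith) ht2 h1, h0]

/-! ### Crossing points of a great circle with a short arc -/

/-- The unit vector of the cone spanned by `A` and `B` that is orthogonal to `p`, when `A` and `B`
lie on different sides of the plane orthogonal to `p`.  If `A` and `B` are strictly on the same
side, the value is meaningless. -/
noncomputable def crossPt (A B p : E3) : E3 :=
  ‖|inner ℝ B p| • A + |inner ℝ A p| • B‖⁻¹ • (|inner ℝ B p| • A + |inner ℝ A p| • B)

theorem inner_frame_eq_zero (e : UnitTangent) {t₀ t₁ : ℝ} (h : t₀ < t₁) (h' : t₁ < t₀ + Real.pi)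
    {p : E3} (h0 : inner ℝ (e.geod t₀ : E3) p = 0) (h1 : inner ℝ (e.geod t₁ : E3) p = 0) :
    inner ℝ e.pt p = 0 ∧ inner ℝ e.dir p = 0 := by
  have hs : Real.sin (t₁ - t₀) ≠ 0 := (Real.sin_pos_of_pos_of_lt_pi (by linarith)
    (by linarith)).ne'
  rw [Real.sin_sub] at hs
  simp only [UnitTangent.coe_geod, inner_add_left, real_inner_smul_left] at h0 h1
  constructor
  · refine (mul_eq_zero.1 ?_).resolve_left hs
    linear_combination Real.sin t₁ * h0 - Real.sin t₀ * h1
  · refine (mul_eq_zero.1 ?_).resolve_left hs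
    linear_combination Real.cos t₀ * h1 - Real.cos t₁ * h0

/-- A point of the half-open arc on a great circle transversal to it is the crossing point, and the
signs of the pole at the endpoints tell that there is one. -/
theorem crossPt_eq (e : UnitTangent) {t₀ t₁ t : ℝ} (ht0 : t₀ ≤ t) (ht1 : t < t₁)
    (h' : t₁ < t₀ + Real.pi) {p : E3} (hp : inner ℝ (e.geod t : E3) p = 0)
    (htr : ¬ (inner ℝ (e.geod t₀ : E3) p = 0 ∧ inner ℝ (e.geod t₁ : E3) p = 0)) :
    crossPt (e.geod t₀) (e.geod t₁) p = e.geod t ∧ inner ℝ (e.geod t₁ : E3) p ≠ 0 ∧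
      (inner ℝ (e.geod t₀ : E3) p = 0 ∧ t = t₀ ∨
        inner ℝ (e.geod t₀ : E3) p * inner ℝ (e.geod t₁ : E3) p < 0) := by
  have hs : 0 < Real.sin (t₁ - t₀) := Real.sin_pos_of_pos_of_lt_pi (by linarith) (by linarith)
  have hα : 0 < Real.sin (t₁ - t) := Real.sin_pos_of_pos_of_lt_pi (by linarith) (by linarith)
  have hβ : 0 ≤ Real.sin (t - t₀) := Real.sin_nonneg_of_nonneg_of_le_pi (by linarith)
    (by linarith)
  have hcomb : Real.sin (t₁ - t₀) • (e.geod t : E3) =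
      Real.sin (t₁ - t) • (e.geod t₀ : E3) + Real.sin (t - t₀) • (e.geod t₁ : E3) := by
    simp only [UnitTangent.coe_geod, smul_add, smul_smul, Real.sin_sub]
    match_scalars
    · ring
    · ring
  set A : E3 := ↑(e.geod t₀)
  set B : E3 := ↑(e.geod t₁)
  set α := Real.sin (t₁ - t)
  set β := Real.sin (t - t₀) with hβdef
  have hrel : α * inner ℝ A p + β * inner ℝ B p = 0 := by
    have := congrArg (fun z => inner ℝ z p) hcomb
    simp only [inner_add_left, real_inner_smul_left, hp, mul_zero] at this
    exact this.symm
  have hb : inner ℝ B p ≠ 0 := by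
    intro hb
    rw [hb, mul_zero, add_zero] at hrel
    exact htr ⟨(mul_eq_zero.1 hrel).resolve_left hα.ne', hb⟩
  have habs : α * |inner ℝ A p| = β * |inner ℝ B p| := by
    have h1 : α * inner ℝ A p = -(β * inner ℝ B p) := by linarith
    have h2 := congrArg abs h1
    rwa [abs_neg, abs_mul, abs_mul, abs_of_pos hα, abs_of_nonneg hβ] at h2
  refine ⟨?_, hb, ?_⟩
  · have hZ : |inner ℝ B p| • A + |inner ℝ A p| • B =
        (|inner ℝ B p| * Real.sin (t₁ - t₀) / α) • (e.geod t : E3) := by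
      have h1 : |inner ℝ A p| = β * |inner ℝ B p| / α := by
        rw [eq_div_iff hα.ne']; linarith
      have h2 : |inner ℝ B p| * Real.sin (t₁ - t₀) / α =
          |inner ℝ B p| / α * Real.sin (t₁ - t₀) := by ring
      rw [h1, h2, mul_smul _ (Real.sin (t₁ - t₀)), hcomb, smul_add, smul_smul, smul_smul,
        div_mul_cancel₀ _ hα.ne']
      congr 2
      ring
    have hc : 0 < |inner ℝ B p| * Real.sin (t₁ - t₀) / α := by positivity
    rw [crossPt, hZ, norm_smul, e.norm_geod, mul_one, Real.norm_of_nonneg hc.le, smul_smul,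
      inv_mul_cancel₀ hc.ne', one_smul]
  · rcases hβ.eq_or_lt with h0 | h0
    · left
      rw [← h0, zero_mul, add_zero] at hrel
      refine ⟨(mul_eq_zero.1 hrel).resolve_left hα.ne', ?_⟩
      have := (Real.sin_eq_zero_iff_of_lt_of_lt (by linarith [Real.pi_pos]) (by linarith)).1
        (hβdef.symm.trans h0.symm)
      linarith
    · right
      have h1 : α * (inner ℝ A p * inner ℝ B p) = -(β * inner ℝ B p ^ 2) := by
        linear_combination inner ℝ B p * hrel
      have h2 : 0 < inner ℝ B p ^ 2 := by positivity
      by_contra! h3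
      nlinarith [mul_pos h0 h2, mul_nonneg hα.le h3]

theorem exists_crossing (e : UnitTangent) {t₀ t₁ : ℝ} (h : t₀ < t₁) {p : E3}
    (hs : inner ℝ (e.geod t₀ : E3) p * inner ℝ (e.geod t₁ : E3) p < 0) :
    ∃ t, t₀ < t ∧ t < t₁ ∧ inner ℝ (e.geod t : E3) p = 0 := by
  have hf : Continuous fun t => inner ℝ (e.geod t : E3) p := by
    have := e.continuous_geod
    fun_prop
  obtain ⟨t, ⟨h0, h1⟩, ht⟩ : ∃ t ∈ Set.Icc t₀ t₁, inner ℝ (e.geod t : E3) p = 0 := by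
    rcases mul_neg_iff.1 hs with ⟨ha, hb⟩ | ⟨ha, hb⟩
    · exact intermediate_value_Icc' h.le hf.continuousOn ⟨hb.le, ha.le⟩
    · exact intermediate_value_Icc h.le hf.continuousOn ⟨ha.le, hb.le⟩
  refine ⟨t, lt_of_le_of_ne h0 ?_, lt_of_le_of_ne h1 ?_, ht⟩
  · rintro rfl
    rw [ht, zero_mul] at hs
    exact hs.false
  · rintro rfl
    rw [ht, mul_zero] at hs
    exact hs.false

/-! ### Pieces of sides -/

namespace SphericalPolygon

variable {P : SphericalPolygon}

/-- The parameter at which the `j`-th cut divides an arc into four equal pieces. -/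
noncomputable def cutTime (a : GeodesicArc) (j : ℕ) : ℝ := a.len / 4 * j

/-- The point of the `x.1`-th side at its `x.2`-th cut; the cuts `0` and `4` are the corners. -/
noncomputable def node (P : SphericalPolygon) (x : Fin P.numSides × Fin 5) : E3 :=
  (P.side x.1).frame.geod (cutTime (P.side x.1) x.2)

/-- A quarter of a side.  Its length is at most `π / 2`, so that a great circle transversal to it
meets it at most once, which may fail for a whole side. -/
abbrev Piece (P : SphericalPolygon) : Type := Fin P.numSides × Fin 4

/-- The point `z` lies on the piece `b`.  A piece contains the cut where it begins, unless this is
a corner, and not the cut where it ends, so that the pieces of a side partition its interior. -/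
def InPiece (P : SphericalPolygon) (b : P.Piece) (z : E3) : Prop :=
  ∃ t, 0 < t ∧ cutTime (P.side b.1) b.2 ≤ t ∧ t < cutTime (P.side b.1) (b.2 + 1) ∧
    z = (P.side b.1).frame.geod t

theorem cutTime_nonneg (a : GeodesicArc) (j : ℕ) : 0 ≤ cutTime a j :=
  mul_nonneg (div_nonneg a.len_pos.le (by norm_num)) j.cast_nonneg

theorem cutTime_lt (a : GeodesicArc) (j : ℕ) : cutTime a j < cutTime a (j + 1) := by
  have := a.len_pos
  simp only [cutTime]; push_cast; linarith

theorem cutTime_succ_lt (a : GeodesicArc) (j : ℕ) : cutTime a (j + 1) < cutTime a j + Real.pi := by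
  have := a.len_le
  have := Real.pi_pos
  simp only [cutTime]; push_cast; linarith

theorem cutTime_mono (a : GeodesicArc) : Monotone (cutTime a) := fun i j h =>
  mul_le_mul_of_nonneg_left (Nat.cast_le.2 h) (div_nonneg a.len_pos.le (by norm_num))

theorem cutTime_four (a : GeodesicArc) : cutTime a 4 = a.len := by
  simp only [cutTime]; push_cast; ring

theorem cutTime_succ_le_len (a : GeodesicArc) (j : Fin 4) : cutTime a (j + 1) ≤ a.len :=
  (cutTime_mono a (by omega : (j : ℕ) + 1 ≤ 4)).trans_eq (cutTime_four a)

theorem InPiece.norm_eq_one {b : P.Piece} {z : E3} (h : P.InPiece b z) : ‖z‖ = 1 := by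
  obtain ⟨t, -, -, -, rfl⟩ := h
  exact UnitTangent.norm_geod _ _

theorem exists_inPiece {i : Fin P.numSides} {z : S2} (h : z ∈ (P.side i).relInterior) :
    ∃ j, P.InPiece (i, j) z := by
  obtain ⟨t, ⟨h0, h1⟩, rfl⟩ := h
  have hl : 0 < (P.side i).len / 4 := by linarith
  have hf0 : 0 ≤ t / ((P.side i).len / 4) := (div_pos h0 hl).le
  have hj : ⌊t / ((P.side i).len / 4)⌋₊ < 4 := by
    rw [Nat.floor_lt hf0, div_lt_iff₀ hl]
    push_cast; linarith
  refine ⟨⟨_, hj⟩, t, h0, ?_, ?_, rfl⟩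
  · have := Nat.floor_le hf0
    rw [le_div_iff₀ hl] at this
    simp only [cutTime]; linarith
  · have := Nat.lt_floor_add_one (t / ((P.side i).len / 4))
    rw [div_lt_iff₀ hl] at this
    simp only [cutTime]; push_cast; linarith

theorem InPiece.exists_mem_relInterior {b : P.Piece} {z : E3} (h : P.InPiece b z) :
    ∃ y ∈ (P.side b.1).relInterior, z = (y : S2) := by
  obtain ⟨t, h0, -, h2, rfl⟩ := h
  exact ⟨_, ⟨t, ⟨h0, h2.trans_le (cutTime_succ_le_len _ _)⟩, rfl⟩, rfl⟩

theorem relInterior_subset_carrier (a : GeodesicArc) : a.relInterior ⊆ a.carrier :=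
  Set.image_mono Set.Ioo_subset_Icc_self

theorem notMem_interior_of_mem_relInterior {i : Fin P.numSides} {y : S2}
    (h : y ∈ (P.side i).relInterior) : y ∉ interior P.carrier := by
  have h1 : y ∈ frontier P.carrier := by
    rw [P.frontier_eq]
    exact Set.mem_iUnion.2 ⟨i, relInterior_subset_carrier _ h⟩
  exact h1.2

theorem InPiece.notMem_interior {b : P.Piece} {y : S2} (h : P.InPiece b y) :
    y ∉ interior P.carrier := by
  obtain ⟨x, hx, hxy⟩ := h.exists_mem_relInterior
  rw [Subtype.ext hxy]
  exact notMem_interior_of_mem_relInterior hx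

theorem InPiece.eq {b b' : P.Piece} {z : E3} (h : P.InPiece b z) (h' : P.InPiece b' z) :
    b = b' := by
  have hside : b.1 = b'.1 := by
    by_contra hne
    obtain ⟨y, hy, hzy⟩ := h.exists_mem_relInterior
    obtain ⟨y', hy', hzy'⟩ := h'.exists_mem_relInterior
    have : y = y' := Subtype.ext (hzy.symm.trans hzy')
    exact Set.disjoint_left.1 (P.disjoint_sides _ _ hne) hy
      (this ▸ relInterior_subset_carrier _ hy')
  obtain ⟨i, j⟩ := b
  obtain ⟨i', j'⟩ := b'
  obtain rfl : i = i' := hside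
  obtain ⟨t, h0, h1, h2, rfl⟩ := h
  obtain ⟨t', h0', h1', h2', heq⟩ := h'
  have hlen := (P.side i).len_le
  have hl := cutTime_succ_le_len (P.side i) j
  have hl' := cutTime_succ_le_len (P.side i) j'
  dsimp only at *
  obtain rfl := UnitTangent.eq_of_geod_eq _ heq (by linarith) (by linarith)
  congr 1
  refine le_antisymm ?_ ?_ <;> by_contra! hlt
  · have := cutTime_mono (P.side i) (Nat.succ_le_of_lt (Fin.lt_def.1 hlt))
    exact absurd (h1.trans_lt h2') this.not_gt
  · have := cutTime_mono (P.side i) (Nat.succ_le_of_lt (Fin.lt_def.1 hlt))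
    exact absurd (h1'.trans_lt h2) this.not_gt

/-- The point where the great circle with pole `p` crosses the piece `b`. -/
noncomputable def crossing (P : SphericalPolygon) (b : P.Piece) (p : E3) : E3 :=
  crossPt (P.node (b.1, b.2.castSucc)) (P.node (b.1, b.2.succ)) p

/-- The great circle with pole `p` crosses the piece `b` transversally. -/
def Crosses (P : SphericalPolygon) (b : P.Piece) (p : E3) : Prop :=
  ¬ (inner ℝ (P.node (b.1, b.2.castSucc)) p = 0 ∧ inner ℝ (P.node (b.1, b.2.succ)) p = 0) ∧
    ∃ z, P.InPiece b z ∧ inner ℝ z p = 0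

theorem Crosses.crossing_eq {b : P.Piece} {p z : E3} (h : P.Crosses b p) (hz : P.InPiece b z)
    (hzp : inner ℝ z p = 0) : P.crossing b p = z := by
  obtain ⟨t, -, h1, h2, rfl⟩ := hz
  exact (crossPt_eq _ h1 h2 (cutTime_succ_lt _ _) hzp h.1).1

theorem Crosses.inPiece_crossing {b : P.Piece} {p : E3} (h : P.Crosses b p) :
    P.InPiece b (P.crossing b p) := by
  obtain ⟨z, hz, hzp⟩ := h.2
  rwa [h.crossing_eq hz hzp]

theorem Crosses.inner_crossing {b : P.Piece} {p : E3} (h : P.Crosses b p) :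
    inner ℝ (P.crossing b p) p = 0 := by
  obtain ⟨z, hz, hzp⟩ := h.2
  rwa [h.crossing_eq hz hzp]

theorem sign_mul_neg_iff {x y : ℝ} :
    x * y < 0 ↔ SignType.sign x * SignType.sign y = -1 := by
  rw [← sign_mul, sign_eq_neg_one_iff]

/-- Which pieces are crossed depends only on the signs at the nodes. -/
theorem Crosses.of_signs {b : P.Piece} {p q : E3} (h : P.Crosses b p)
    (hpq : PiecewiseIsometry.signs P.node p = PiecewiseIsometry.signs P.node q) :
    P.Crosses b q := by
  have hsign : ∀ x, SignType.sign (inner ℝ (P.node x) p) = SignType.sign (inner ℝ (P.node x) q) :=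
    fun x => congrFun hpq x
  have hzero : ∀ x, inner ℝ (P.node x) p = 0 ↔ inner ℝ (P.node x) q = 0 := by
    intro x
    rw [← sign_eq_zero_iff, hsign, sign_eq_zero_iff]
  refine ⟨by rw [← hzero, ← hzero]; exact h.1, ?_⟩
  obtain ⟨htr, z, ⟨t, h0, h1, h2, rfl⟩, hzp⟩ := h
  obtain ⟨-, -, h3 | h3⟩ := crossPt_eq _ h1 h2 (cutTime_succ_lt _ _) hzp htr
  -- If the circle of `p` passes through the first node of `b`, so does the circle of `q`.
  · refine ⟨_, ⟨t, h0, h1, h2, rfl⟩, ?_⟩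
    rw [h3.2]
    exact (hzero (b.1, b.2.castSucc)).1 h3.1
  · have h4 : inner ℝ (P.node (b.1, b.2.castSucc)) q * inner ℝ (P.node (b.1, b.2.succ)) q < 0 := by
      rw [sign_mul_neg_iff, ← hsign, ← hsign, ← sign_mul_neg_iff]
      exact h3
    obtain ⟨s, h5, h6, h7⟩ := exists_crossing (P.side b.1).frame (cutTime_lt _ b.2) h4
    exact ⟨_, ⟨s, (cutTime_nonneg _ _).trans_lt h5, h5.le, h6, rfl⟩, h7⟩

theorem signs_segment {p q : E3}
    (hpq : PiecewiseIsometry.signs P.node p = PiecewiseIsometry.signs P.node q) {s : ℝ}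
    (hs : s ∈ Set.Icc (0 : ℝ) 1) :
    PiecewiseIsometry.signs P.node p = PiecewiseIsometry.signs P.node ((1 - s) • p + s • q) := by
  funext x
  have hx : SignType.sign (inner ℝ (P.node x) p) = SignType.sign (inner ℝ (P.node x) q) :=
    congrFun hpq x
  change SignType.sign _ = SignType.sign _
  rw [inner_add_right, inner_smul_right, inner_smul_right]
  have hs' : 0 < 1 - s ∨ 0 < s := by
    by_contra! h
    linarith
  have h1 : 0 ≤ 1 - s := by linarith [hs.2]
  have h0 := hs.1
  rcases lt_trichotomy (inner ℝ (P.node x) p) 0 with h | h | h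
  · rw [sign_neg h] at hx ⊢
    have h' := sign_eq_neg_one_iff.1 hx.symm
    refine (sign_neg ?_).symm
    rcases hs' with h2 | h2
    · exact add_neg_of_neg_of_nonpos (mul_neg_of_pos_of_neg h2 h)
        (mul_nonpos_of_nonneg_of_nonpos h0 h'.le)
    · exact add_neg_of_nonpos_of_neg (mul_nonpos_of_nonneg_of_nonpos h1 h.le)
        (mul_neg_of_pos_of_neg h2 h')
  · rw [h, sign_zero] at hx
    rw [h, sign_eq_zero_iff.1 hx.symm]
    simp
  · rw [sign_pos h] at hx ⊢
    have h' := sign_eq_one_iff.1 hx.symm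
    refine (sign_pos ?_).symm
    rcases hs' with h2 | h2
    · exact add_pos_of_pos_of_nonneg (mul_pos h2 h) (mul_nonneg h0 h'.le)
    · exact add_pos_of_nonneg_of_pos (mul_nonneg h1 h.le) (mul_pos h2 h')

theorem continuousOn_crossing {b : P.Piece} {f : ℝ → E3} (hf : Continuous f) {s : Set ℝ}
    (h : ∀ t ∈ s, P.Crosses b (f t)) : ContinuousOn (fun t => P.crossing b (f t)) s := by
  unfold crossing crossPt
  have hZ : Continuous fun t => |inner ℝ (P.node (b.1, b.2.succ)) (f t)| •
      P.node (b.1, b.2.castSucc) + |inner ℝ (P.node (b.1, b.2.castSucc)) (f t)| •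
      P.node (b.1, b.2.succ) := by fun_prop
  refine (hZ.norm.continuousOn.inv₀ ?_).smul hZ.continuousOn
  intro t ht h0
  have h1 := (h t ht).inPiece_crossing.norm_eq_one
  rw [crossing, crossPt, h0, inv_zero, zero_smul, norm_zero] at h1
  exact zero_ne_one h1

/-! ### Chords and the pieces where they end -/

/-- The side meets an endpoint of the chord at an angle: otherwise the chord would run along it. -/
theorem RegularChord.crosses (c : P.RegularChord) {L : ℝ} (hL : L = 0 ∨ L = c.len) {b : P.Piece}
    (hb : P.InPiece b (c.start.geod L)) : P.Crosses b c.start.pole := by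
  refine ⟨fun ⟨h0, h1⟩ => ?_, _, hb, c.start.inner_geod_pole L⟩
  obtain ⟨hpt, hdir⟩ := inner_frame_eq_zero _ (cutTime_lt _ _) (cutTime_succ_lt _ _) h0 h1
  obtain ⟨t, ht0, -, ht1, heq⟩ := hb
  replace ht1 := ht1.trans_le (cutTime_succ_le_len _ _)
  obtain ⟨σ, hσ, hrun⟩ := UnitTangent.geod_eq_geod_of_inner_pole_eq_zero heq hpt hdir
  obtain ⟨ε, hε0, hεc, hεt, hεl⟩ : ∃ ε, 0 < ε ∧ ε < c.len ∧ ε < t ∧ ε < (P.side b.1).len - t := by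
    obtain ⟨ε, h1, h2⟩ := exists_between
      (show 0 < min c.len (min t ((P.side b.1).len - t)) from
        lt_min c.len_pos (lt_min ht0 (by linarith)))
    simp only [lt_min_iff] at h2
    exact ⟨ε, h1, h2⟩
  -- A small step from the endpoint into the chord is also a small step along the side.
  obtain ⟨r, hr, hin⟩ : ∃ r, |r| = ε ∧ L + r ∈ Set.Ioo 0 c.len := by
    rcases hL with rfl | rfl
    · exact ⟨ε, abs_of_pos hε0, by rw [zero_add]; exact ⟨hε0, hεc⟩⟩
    · exact ⟨-ε, by rw [abs_neg, abs_of_pos hε0], by constructor <;> linarith⟩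
  have habs : |σ * r| = ε := by rw [abs_mul, hσ, hr, one_mul]
  have h2 := abs_le.1 habs.le
  have hmem : c.start.geod (L + r) ∈ (P.side b.1).relInterior :=
    ⟨t + σ * r, ⟨by linarith, by linarith⟩, Subtype.ext (hrun r).symm⟩
  exact notMem_interior_of_mem_relInterior hmem (c.inside _ hin)

/-- The chord reaches the pieces that its great circle crosses only at its end or later. -/
theorem RegularChord.exists_crossing_eq (c : P.RegularChord) {a b : P.Piece}
    (ha : P.InPiece a (c.start.geod 0)) (hab : a ≠ b) (hb : P.Crosses b c.start.pole) :
    ∃ t, c.len ≤ t ∧ t < 2 * Real.pi ∧ P.crossing b c.start.pole = c.start.geod t := by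
  have hin := hb.inPiece_crossing
  obtain ⟨t, ht0, ht2, heq⟩ := c.start.exists_geod_eq hin.norm_eq_one hb.inner_crossing
  refine ⟨t, ?_, ht2, heq⟩
  rw [heq] at hin
  by_contra! hlt
  rcases ht0.eq_or_lt with rfl | h0
  · exact hab (ha.eq hin)
  · exact hin.notMem_interior (c.inside t ⟨h0, hlt⟩)

/-- A chord that returns to the piece where it starts runs through its whole great circle, which
then crosses no other piece. -/
theorem RegularChord.end_ne_of_crosses (c : P.RegularChord) {a b : P.Piece}
    (ha : P.InPiece a (c.start.geod 0)) (hab : a ≠ b) (hb : P.Crosses b c.start.pole) :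
    ¬ P.InPiece a (c.start.geod c.len) := by
  intro hend
  have hX := c.crosses (Or.inl rfl) ha
  have h1 := (hX.crossing_eq ha (c.start.inner_geod_pole _)).symm.trans
    (hX.crossing_eq hend (c.start.inner_geod_pole _))
  obtain ⟨t, h2, h3, -⟩ := c.exists_crossing_eq ha hab hb
  have h4 := c.len_pos
  have := c.start.eq_of_geod_eq h1 (by linarith [Real.pi_pos]) (by linarith)
  linarith

/-- A chord ending in `b` meets, after its start, the piece `b` before any other piece `b'`. -/
theorem RegularChord.signedArea_neg (c : P.RegularChord) {a b b' : P.Piece}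
    (ha : P.InPiece a (c.start.geod 0)) (hb : P.InPiece b (c.start.geod c.len))
    (hab' : a ≠ b') (hbb' : b ≠ b') (hb' : P.Crosses b' c.start.pole) :
    signedArea c.start.pole (P.crossing a c.start.pole) (P.crossing b' c.start.pole)
      (P.crossing b c.start.pole) < 0 := by
  obtain ⟨t, h1, h2, heq⟩ := c.exists_crossing_eq ha hab' hb'
  have hlt : c.len < t := by
    refine lt_of_le_of_ne h1 fun h => hbb' ?_
    have := hb'.inPiece_crossing
    rw [heq, ← h] at this
    exact hb.eq this
  have h0 := c.len_pos
  rw [(c.crosses (Or.inl rfl) ha).crossing_eq ha (c.start.inner_geod_pole _),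
    (c.crosses (Or.inr rfl) hb).crossing_eq hb (c.start.inner_geod_pole _), heq,
    signedArea_geod]
  have s1 : 0 < Real.sin (t / 2) := Real.sin_pos_of_pos_of_lt_pi (by linarith) (by linarith)
  have s2 : Real.sin ((c.len - t) / 2) < 0 :=
    Real.sin_neg_of_neg_of_neg_pi_lt (by linarith) (by linarith)
  have s3 : 0 < Real.sin (c.len / 2) := Real.sin_pos_of_pos_of_lt_pi (by linarith) (by linarith)
  exact mul_neg_of_neg_of_pos (mul_neg_of_pos_of_neg (by positivity) s2) s3

theorem continuousOn_signedArea {n a b c : ℝ → E3} {s : Set ℝ} (hn : ContinuousOn n s)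
    (ha : ContinuousOn a s) (hb : ContinuousOn b s) (hc : ContinuousOn c s) :
    ContinuousOn (fun t => signedArea (n t) (a t) (b t) (c t)) s := by
  simp only [signedArea, inner_eq_sum_three, cross]
  simp only [Matrix.cons_val]
  fun_prop

/-- Two chords that start in the same piece, and whose great circles have poles with the same signs
at all nodes, end in the same piece.  Along the segment joining the poles all signs persist, and
with them the crossings with the pieces; two crossings cannot change their cyclic order,
because the pieces are disjoint. -/
theorem RegularChord.end_piece_eq {c c' : P.RegularChord} {a b b' : P.Piece}
    (ha : P.InPiece a (c.start.geod 0)) (ha' : P.InPiece a (c'.start.geod 0))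
    (hb : P.InPiece b (c.start.geod c.len)) (hb' : P.InPiece b' (c'.start.geod c'.len))
    (hsigns : PiecewiseIsometry.signs P.node c.start.pole =
      PiecewiseIsometry.signs P.node c'.start.pole) : b = b' := by
  by_contra hbb'
  have hXa := c.crosses (Or.inl rfl) ha
  have hXb := c.crosses (Or.inr rfl) hb
  have hXb' := (c'.crosses (Or.inr rfl) hb').of_signs hsigns.symm
  have hab : a ≠ b := by
    rintro rfl
    exact c.end_ne_of_crosses ha hbb' hXb' hb
  have hab' : a ≠ b' := by
    rintro rfl
    exact c'.end_ne_of_crosses ha' (Ne.symm hbb') (hXb.of_signs hsigns) hb'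
  let p : ℝ → E3 := fun s => (1 - s) • c.start.pole + s • c'.start.pole
  have hp : Continuous p := by fun_prop
  have hp0 : p 0 = c.start.pole := by simp [p]
  have hp1 : p 1 = c'.start.pole := by simp [p]
  have hcr : ∀ {d : P.Piece}, P.Crosses d c.start.pole →
      ∀ s ∈ Set.Icc (0 : ℝ) 1, P.Crosses d (p s) :=
    fun h s hs => h.of_signs (signs_segment hsigns hs)
  have hcont := continuousOn_signedArea (s := Set.Icc (0 : ℝ) 1) hp.continuousOn
    (continuousOn_crossing hp (hcr hXa)) (continuousOn_crossing hp (hcr hXb'))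
    (continuousOn_crossing hp (hcr hXb))
  have h0 := c.signedArea_neg ha hb hab' hbb' hXb'
  have h1 := c'.signedArea_neg ha' hb' hab (Ne.symm hbb') (hXb.of_signs hsigns)
  -- Exchanging the roles of `b` and `b'` reverses the cyclic order, so the signed area of the three
  -- crossings is negative at `s = 0` and positive at `s = 1`.
  rw [signedArea_swap, neg_lt_zero] at h1
  rw [← hp0] at h0
  rw [← hp1] at h1
  obtain ⟨s, hs, hzero⟩ := intermediate_value_Icc zero_le_one hcont ⟨h0.le, h1.le⟩
  have ka := hcr hXa s hs
  have kb := hcr hXb s hs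
  have kb' := hcr hXb' s hs
  have hps : p s ≠ 0 := by
    intro h
    apply ka.1
    simp [h]
  rcases eq_or_eq_of_signedArea_eq_zero hps ka.inPiece_crossing.norm_eq_one
      kb'.inPiece_crossing.norm_eq_one kb.inPiece_crossing.norm_eq_one ka.inner_crossing
      kb'.inner_crossing kb.inner_crossing hzero with h | h | h
  · exact hab' ((h ▸ ka.inPiece_crossing).eq kb'.inPiece_crossing)
  · exact hbb' (kb.inPiece_crossing.eq (h ▸ kb'.inPiece_crossing))
  · exact hab (ka.inPiece_crossing.eq (h ▸ kb.inPiece_crossing))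

/-! ### Side codes as itineraries of poles -/

theorem RegularChord.exists_start_piece (c : P.RegularChord) :
    ∃ b : P.Piece, b.1 = c.firstSide ∧ P.InPiece b (c.start.geod 0) :=
  let ⟨j, hj⟩ := exists_inPiece c.begin_mem
  ⟨(_, j), rfl, hj⟩

theorem RegularChord.exists_end_piece (c : P.RegularChord) :
    ∃ b : P.Piece, b.1 = c.lastSide ∧ P.InPiece b (c.start.geod c.len) :=
  let ⟨j, hj⟩ := exists_inPiece c.end_mem
  ⟨(_, j), rfl, hj⟩

/-- The piece where a chord ends. -/
noncomputable def RegularChord.endPiece (c : P.RegularChord) : P.Piece := c.exists_end_piece.choose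

theorem RegularChord.endPiece_fst (c : P.RegularChord) : c.endPiece.1 = c.lastSide :=
  c.exists_end_piece.choose_spec.1

theorem RegularChord.inPiece_endPiece (c : P.RegularChord) :
    P.InPiece c.endPiece (c.start.geod c.len) := c.exists_end_piece.choose_spec.2

/-- The action on poles of the reflection in the side of a piece. -/
noncomputable def poleMap (P : SphericalPolygon) (b : P.Piece) : E3 ≃ₗᵢ[ℝ] E3 :=
  (P.side b.1).reflection.trans (LinearIsometryEquiv.neg ℝ)

open Classical in
/-- The piece where a chord ends that starts in the piece `a` and whose pole has the signs `σ` at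
the nodes; the piece `a` itself if there is no such chord. -/
noncomputable def nextPiece (P : SphericalPolygon) (a : P.Piece)
    (σ : Fin P.numSides × Fin 5 → SignType) : P.Piece :=
  if h : ∃ c : P.RegularChord, P.InPiece a (c.start.geod 0) ∧
      PiecewiseIsometry.signs P.node c.start.pole = σ then h.choose.endPiece else a

/-- The choice made in `nextPiece` is immaterial, by `RegularChord.end_piece_eq`. -/
theorem nextPiece_eq (c : P.RegularChord) {a : P.Piece} (ha : P.InPiece a (c.start.geod 0)) :
    P.nextPiece a (PiecewiseIsometry.signs P.node c.start.pole) = c.endPiece := by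
  have h : ∃ c' : P.RegularChord, P.InPiece a (c'.start.geod 0) ∧
      PiecewiseIsometry.signs P.node c'.start.pole =
        PiecewiseIsometry.signs P.node c.start.pole := ⟨c, ha, rfl⟩
  rw [nextPiece, dif_pos h]
  exact RegularChord.end_piece_eq h.choose_spec.1 ha (RegularChord.inPiece_endPiece _)
    c.inPiece_endPiece h.choose_spec.2

theorem BilliardNext.pole_eq {c c' : P.RegularChord} (h : P.BilliardNext c c') :
    c'.start.pole = P.poleMap c.endPiece c.start.pole := by
  rw [h, GeodesicArc.pole_map_reflection, UnitTangent.pole_flow, ← c.endPiece_fst]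
  rfl

theorem BilliardNext.inPiece {c c' : P.RegularChord} (h : P.BilliardNext c c') :
    P.InPiece c.endPiece (c'.start.geod 0) := by
  have h1 : (c'.start.geod 0 : E3) = c.start.geod c.len := by
    obtain ⟨t, -, ht⟩ := c.end_mem
    have h2 : (P.side c.lastSide).reflection (c.start.geod c.len : E3) = c.start.geod c.len := by
      rw [← ht]
      exact Submodule.reflection_mem_subspace_eq_self
        (Submodule.mem_span_pair.2 ⟨_, _, rfl⟩)
    rw [h, UnitTangent.coe_geod, Real.cos_zero, Real.sin_zero, one_smul, zero_smul, add_zero]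
    exact h2
  rw [h1]
  exact c.inPiece_endPiece

/-- The rule that reads off the next piece from the last one and the signs of the pole. -/
noncomputable def pieceRule (P : SphericalPolygon) (a : P.Piece) (w : List P.Piece)
    (σ : Fin P.numSides × Fin 5 → SignType) : P.Piece :=
  P.nextPiece ((a :: w).getLast (List.cons_ne_nil a w)) σ

/-- The pieces where the chords of an orbit end are the itinerary of the pole of its first chord. -/
theorem itin_pieceRule {n : ℕ} {x : Fin n → P.RegularChord} (hx : P.IsRegularOrbit x)
    {a : P.Piece} {p : E3}
    (h : ∀ hn : 0 < n, (x ⟨0, hn⟩).start.pole = p ∧ P.InPiece a ((x ⟨0, hn⟩).start.geod 0)) :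
    PiecewiseIsometry.itin P.node P.poleMap (P.pieceRule a) n p =
      List.ofFn fun k => (x k).endPiece := by
  induction n generalizing a p with
  | zero => simp [PiecewiseIsometry.itin]
  | succ n ih =>
    obtain ⟨rfl, ha⟩ := h (Nat.succ_pos n)
    have h0 : P.pieceRule a [] (PiecewiseIsometry.signs P.node (x 0).start.pole) =
        (x 0).endPiece := nextPiece_eq (x 0) ha
    rw [List.ofFn_succ]
    change _ :: PiecewiseIsometry.itin P.node P.poleMap (fun u => P.pieceRule a
      (P.pieceRule a [] (PiecewiseIsometry.signs P.node (x 0).start.pole) :: u)) n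
      (P.poleMap (P.pieceRule a [] (PiecewiseIsometry.signs P.node (x 0).start.pole))
        (x 0).start.pole) = _
    rw [h0]
    congr 1
    have hrule : (fun u => P.pieceRule a ((x 0).endPiece :: u)) = P.pieceRule (x 0).endPiece := by
      funext u σ
      simp only [pieceRule, List.getLast_cons_cons]
    rw [hrule]
    refine ih (x := fun k => x k.succ) (fun k l hkl => hx _ _ (by simp [hkl])) fun hn => ?_
    have hnext : P.BilliardNext (x 0) (x (Fin.succ ⟨0, hn⟩)) := hx _ _ (by simp)
    exact ⟨hnext.pole_eq, hnext.inPiece⟩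

/-- The side code of an orbit that starts in the piece `a` and ends its chords in the pieces of
`l`. -/
def sideCode (P : SphericalPolygon) (n : ℕ) (a : P.Piece) (l : List P.Piece)
    (k : Fin (n + 1)) : Fin P.numSides :=
  ((a :: l).getD k a).1

theorem norm_node (x : Fin P.numSides × Fin 5) : ‖P.node x‖ = 1 := UnitTangent.norm_geod _ _

theorem exists_sideComplexity_le (P : SphericalPolygon) {ε : ℝ} (hε : 0 < ε) :
    ∃ C : ℝ, ∀ n : ℕ, 0 < n → (P.sideComplexity n : ℝ) ≤ C * Real.exp (ε * n) := by
  classical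
  obtain ⟨C, hC⟩ := PiecewiseIsometry.exists_itin_bound P.node P.poleMap
    (fun x => (norm_node x).le) hε
  refine ⟨Fintype.card P.Piece * C, fun n hn => ?_⟩
  choose L hL hmem using fun a : P.Piece => hC (P.pieceRule a) n
  let W := Finset.univ.biUnion fun a : P.Piece => (L a).image (P.sideCode n a)
  have hsub : P.sideWords n ⊆ W := by
    rintro w ⟨x, hx, hcode⟩
    obtain ⟨m, rfl⟩ := Nat.exists_eq_succ_of_ne_zero hn.ne'
    obtain ⟨a, ha1, ha⟩ := (x 0).exists_start_piece
    have hit := itin_pieceRule hx (a := a) (p := (x 0).start.pole) fun _ => ⟨rfl, ha⟩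
    refine Finset.mem_coe.2 (Finset.mem_biUnion.2 ⟨a, Finset.mem_univ a,
      Finset.mem_image.2 ⟨_, hmem a (x 0).start.pole, ?_⟩⟩)
    rw [hit]
    funext k
    refine Fin.cases ?_ (fun k => ?_) k
    · rw [← Fin.castSucc_zero, ← (hcode 0).1]
      exact ha1
    · rw [← (hcode k).2, ← RegularChord.endPiece_fst]
      change ((List.ofFn fun i => (x i).endPiece).getD k a).1 = _
      rw [List.getD_eq_getElem _ _ (by rw [List.length_ofFn]; exact k.2), List.getElem_ofFn]
  have hcard : P.sideComplexity n ≤ ∑ a : P.Piece, (L a).card := by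
    calc P.sideComplexity n ≤ (W : Set (Fin (n + 1) → Fin P.numSides)).ncard :=
          Set.ncard_le_ncard hsub W.finite_toSet
      _ = W.card := Set.ncard_coe_finset W
      _ ≤ _ := Finset.card_biUnion_le.trans (Finset.sum_le_sum fun a _ => Finset.card_image_le)
  calc (P.sideComplexity n : ℝ) ≤ ((∑ a : P.Piece, (L a).card : ℕ) : ℝ) := by exact_mod_cast hcard
    _ = ∑ a : P.Piece, ((L a).card : ℝ) := by push_cast; rfl
    _ ≤ Finset.univ.card • (C * Real.exp (ε * n)) := Finset.sum_le_card_nsmul _ _ _ fun a _ => hL a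
    _ = Fintype.card P.Piece * C * Real.exp (ε * n) := by
      rw [nsmul_eq_mul, Finset.card_univ, mul_assoc]

end SphericalPolygon

theorem theorem4 (P : SphericalPolygon) : SubexponentialGrowth P.sideComplexity := by
  intro ε hε
  obtain ⟨C, hC⟩ := P.exists_sideComplexity_le (half_pos hε)
  have hO : (fun n : ℕ => (P.sideComplexity n : ℝ)) =O[atTop]
      fun n : ℕ => Real.exp (ε / 2 * n) := by
    refine IsBigO.of_bound C ?_
    filter_upwards [eventually_gt_atTop 0] with n hn
    rw [Real.norm_of_nonneg (Nat.cast_nonneg _), Real.norm_of_nonneg (Real.exp_pos _).le]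
    exact hC n hn
  refine hO.trans_isLittleO ?_
  rw [Real.isLittleO_exp_comp_exp_comp]
  have h : (fun n : ℕ => ε * n - ε / 2 * n) = fun n : ℕ => ε / 2 * (n : ℝ) := by
    funext n; ring
  rw [h]
  exact tendsto_natCast_atTop_atTop.const_mul_atTop (half_pos hε)
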